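/- Let $\Phi$ be a finite irreducible reduced crystallographic root system spanning a Euclidean space $E$ with scalar product $(\cdot,\cdot)$, let $W$ be its Weyl group, let $\Pi=\{\alpha_1,\dots,\alpha_n\}$ be a basis of simple roots, let $\breve\omega_1,\dots,\breve\omega_n\in E$ be the fundamental coweights (the basis of $E$ dual to $\Pi$, i.e. $(\breve\omega_i,\alpha_j)=\delta_{ij}$), and let $\theta=\sum_{i} m_i\alpha_i$ be the highest root. Let $\mathcal P_\Phi$ be the convex hull of $\Phi$. A face of $\mathcal P_\Phi$ is either $\mathcal P_\Phi$ itself or a nonempty intersection of $\mathcal P_\Phi$ with a supporting hyperplane. For $I\subseteq\{1,\dots,n\}$ define the standard parabolic face $$F_I=\{x\in\mathcal P_\Phi \mid (\breve\omega_i,x)=m_i \text{ for all } i\in I\},\qquad F_\emptyset=\mathcal P_\Phi .$$ Two distinct standard parabolic faces cannot be transformed into one another by elements of $W$: if $F_I\neq F_J$, then $w(F_I)\neq F_J$ for every $w\in W$. Moreover, $W$ permutes the faces of $\mathcal P_\Phi$, every $F_I$ is a face, and the sets $F_I$ (where $F_I$ and $F_J$ are identified when they are equal) form a complete set of representatives of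 the $W$-orbits of faces: for every face $F$ of $\mathcal P_\Phi$ there is exactly one set $G$ in $\{F_I \mid I\subseteq\{1,\dots,n\}\}$ such that $w(F)=G$ for some $w\in W$. -/

import Mathlib

open scoped InnerProductSpace

namespace RootPolytope

noncomputable section

section HighestRoot

variable {ι M N : Type*} [AddCommGroup M] [Module ℝ M] [AddCommGroup N] [Module ℝ N]
  {P : RootPairing ι ℝ M N}

/-- The root with index `i` is the highest root with respect to the base `b`: for every root `β`,
the difference `θ - β` is a sum of simple roots (possibly the empty sum). -/
def IsHighestRoot (b : P.Base) (i : ι) : Prop :=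
  ∀ j, P.root i - P.root j ∈ AddSubmonoid.closure (P.root '' (b.support : Set ι))

lemma root_mem_closure_of_isPos [Finite ι] [P.IsCrystallographic] {b : P.Base} {i : ι}
    (hi : b.IsPos i) : P.root i ∈ AddSubmonoid.closure (P.root '' (b.support : Set ι)) := by
  refine hi.induction_on_add (p := fun i => P.root i ∈ AddSubmonoid.closure _) ?_ ?_
  · intro j hj
    exact AddSubmonoid.subset_closure ⟨j, hj, rfl⟩
  · intro j k l hl hj hk
    rw [hl]
    exact add_mem hj (AddSubmonoid.subset_closure ⟨k, hk, rfl⟩)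

/-- A root which is of maximal height among the roots above `j` is dominant. -/
lemma pairingIn_nonneg_of_max [Finite ι] [P.IsCrystallographic] (b : P.Base) {i j : ι}
    (hij : P.root i - P.root j ∈ AddSubmonoid.closure (P.root '' (b.support : Set ι)))
    (hmax : ∀ l, P.root l - P.root j ∈ AddSubmonoid.closure (P.root '' (b.support : Set ι)) →
      b.height l ≤ b.height i) {k : ι} (hk : k ∈ b.support) : 0 ≤ P.pairingIn ℤ i k := by
  by_contra! hneg
  have hkc : P.root k ∈ AddSubmonoid.closure (P.root '' (b.support : Set ι)) :=
    AddSubmonoid.subset_closure ⟨k, hk, rfl⟩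
  have hk1 := RootPairing.Base.height_one_of_mem_support hk
  by_cases h : P.root i = -P.root k
  · have h1 : b.height k ≤ b.height i := by
      apply hmax
      have : P.root k - P.root j = (P.root i - P.root j) + (P.root k + P.root k) := by
        rw [h]; abel
      rw [this]
      exact add_mem hij (add_mem hkc hkc)
    let := P.indexNeg
    have h2 : i = -k := by
      apply P.root.injective
      simpa using h
    rw [h2, b.height_reflectionPerm_self] at h1
    lia
  · obtain ⟨l, hl⟩ := P.root_add_root_mem_of_pairingIn_neg hneg h
    have h1 : b.height l ≤ b.height i := by
      apply hmax
      have : P.root l - P.root j = (P.root i - P.root j) + P.root k := by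
        rw [hl]; abel
      rw [this]
      exact add_mem hij hkc
    rw [b.height_add hl] at h1
    lia

/-- A positive dominant root of an irreducible root system has full support. -/
lemma coeff_ne_zero_of_dominant [Finite ι] [P.IsCrystallographic] [P.IsReduced] [P.IsIrreducible]
    (b : P.Base) {i : ι} {f : ι → ℤ} (hf : P.root i = ∑ j ∈ b.support, f j • P.root j)
    (hf0 : 0 ≤ f) (hdom : ∀ k ∈ b.support, 0 ≤ P.pairingIn ℤ i k) :
    ∀ k ∈ b.support, f k ≠ 0 := by
  classical
  set S : Set ι := {j | j ∈ b.support ∧ f j ≠ 0} with hS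
  set q : Submodule ℝ M := Submodule.span ℝ (P.root '' S) with hq
  have hiq : P.root i ∈ q := by
    rw [hf]
    refine Submodule.sum_mem _ fun j hj => ?_
    by_cases h : f j = 0
    · simp [h]
    · have hjS : j ∈ S := ⟨hj, h⟩
      have hjq : P.root j ∈ q := Submodule.subset_span (Set.mem_image_of_mem _ hjS)
      exact zsmul_mem hjq (f j)
  have hinv : ∀ k ∈ b.support, q ∈ Module.End.invtSubmodule (P.reflection k) := by
    intro k hk
    by_cases hkS : f k = 0
    · have hsum : P.pairingIn ℤ i k = ∑ j ∈ b.support, f j * P.pairingIn ℤ j k :=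
        FaithfulSMul.algebraMap_injective ℤ ℝ <| by
          simp_rw [RootPairing.algebraMap_pairingIn, map_sum, ← RootPairing.root_coroot_eq_pairing,
            hf, map_sum, map_zsmul, LinearMap.coe_sum, Finset.sum_apply, LinearMap.smul_apply,
            RootPairing.root_coroot_eq_pairing, zsmul_eq_mul, map_mul,
            RootPairing.algebraMap_pairingIn]
          simp
      have hterm : ∀ j ∈ b.support, f j * P.pairingIn ℤ j k ≤ 0 := by
        intro j hj
        rcases eq_or_ne j k with rfl | hjk
        · simp [hkS]
        · exact mul_nonpos_of_nonneg_of_nonpos (hf0 j) (b.pairingIn_le_zero_of_ne hjk hj hk)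
      have hzero : ∀ j ∈ b.support, f j * P.pairingIn ℤ j k = 0 := by
        refine (Finset.sum_eq_zero_iff_of_nonpos hterm).mp ?_
        exact le_antisymm (Finset.sum_nonpos hterm) (hsum ▸ hdom k hk)
      have hker : q ≤ LinearMap.ker (P.coroot' k) := by
        refine Submodule.span_le.mpr ?_
        rintro _ ⟨j, ⟨hj, hfj⟩, rfl⟩
        have h0 : P.pairingIn ℤ j k = 0 := (mul_eq_zero.mp (hzero j hj)).resolve_left hfj
        have h1 : P.pairing j k = 0 := by
          rw [← P.algebraMap_pairingIn ℤ, h0, map_zero]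
        simpa using h1
      refine (Module.End.mem_invtSubmodule _).mpr fun x hx => ?_
      have h2 : P.coroot' k x = 0 := hker hx
      rw [Submodule.mem_comap, LinearEquiv.coe_coe, P.reflection_apply, h2]
      simpa using hx
    · refine (Module.End.mem_invtSubmodule _).mpr fun x hx => ?_
      rw [Submodule.mem_comap, LinearEquiv.coe_coe, P.reflection_apply]
      exact q.sub_mem hx (q.smul_mem _ (Submodule.subset_span ⟨k, ⟨hk, hkS⟩, rfl⟩))
  have hne : q ≠ ⊥ := by
    intro h
    rw [h, Submodule.mem_bot] at hiq
    exact P.ne_zero i hiq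
  have htop : q = ⊤ := RootPairing.IsIrreducible.eq_top_of_invtSubmodule_reflection (P := P) q
    ((b.forall_mem_support_invtSubmodule_iff q).mp hinv) hne
  intro k hk hfk
  refine b.linearIndepOn_root.notMem_span (i := k) hk ?_
  have hSsub : S ⊆ (b.support : Set ι) \ {k} := by
    rintro j ⟨hj, hfj⟩
    exact ⟨hj, fun h => hfj (by rw [Set.mem_singleton_iff.mp h]; exact hfk)⟩
  refine Submodule.span_mono (Set.image_mono hSsub) ?_
  change P.root k ∈ q
  rw [htop]
  exact Submodule.mem_top

lemma exists_isHighestRoot [Finite ι] [P.IsRootSystem] [P.IsCrystallographic] [P.IsReduced]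
    [P.IsIrreducible] (b : P.Base) : ∃ i, IsHighestRoot b i := by
  classical
  have hnt : Nontrivial M := RootPairing.IsIrreducible.nontrivial P
  have hne : Nonempty ι := by
    by_contra h
    rw [not_nonempty_iff] at h
    have := RootPairing.IsRootSystem.span_root_eq_top (P := P)
    rw [Set.range_eq_empty, Submodule.span_empty] at this
    exact bot_ne_top this
  obtain ⟨i, hi⟩ := Finite.exists_max b.height
  obtain ⟨k₀, hk₀⟩ := b.support_nonempty
  have hipos : 0 < b.height i := by
    have := hi k₀
    rw [RootPairing.Base.height_one_of_mem_support hk₀] at this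
    lia
  obtain ⟨f, -, hf₁, hf⟩ := b.exists_root_eq_sum_int i
  have hf0 : 0 ≤ f := by
    refine (hf₁.resolve_right fun hneg => ?_).le
    rw [RootPairing.Base.height_eq_sum hf] at hipos
    exact hipos.not_ge (Finset.sum_nonpos fun j _ => hneg.le j)
  have hidom : ∀ k ∈ b.support, 0 ≤ P.pairingIn ℤ i k := fun k hk =>
    pairingIn_nonneg_of_max b (j := i) (by simp) (fun l _ => hi l) hk
  have hfull := coeff_ne_zero_of_dominant b hf hf0 hidom
  refine ⟨i, fun j => ?_⟩
  set T : Set ι :=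
    {l | P.root l - P.root j ∈ AddSubmonoid.closure (P.root '' (b.support : Set ι))} with hT
  obtain ⟨j', hj'T, hj'⟩ := T.toFinite.exists_maximalFor b.height T ⟨j, by simp [hT]⟩
  have hmax : ∀ l ∈ T, b.height l ≤ b.height j' := fun l hl => by
    by_contra! h
    exact h.not_ge (hj' hl h.le)
  have hj'dom : ∀ k ∈ b.support, 0 ≤ P.pairingIn ℤ j' k := fun k hk =>
    pairingIn_nonneg_of_max b hj'T hmax hk
  have hswap : ∀ k ∈ b.support, 0 ≤ P.pairingIn ℤ k j' := fun k hk => by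
    by_contra! h
    exact (hj'dom k hk).not_gt ((P.pairingIn_lt_zero_iff ℤ).mp h)
  have hsum : P.pairingIn ℤ i j' = ∑ k ∈ b.support, f k * P.pairingIn ℤ k j' :=
    FaithfulSMul.algebraMap_injective ℤ ℝ <| by
      simp_rw [RootPairing.algebraMap_pairingIn, map_sum, ← RootPairing.root_coroot_eq_pairing,
        hf, map_sum, map_zsmul, LinearMap.coe_sum, Finset.sum_apply, LinearMap.smul_apply,
        RootPairing.root_coroot_eq_pairing, zsmul_eq_mul, map_mul,
        RootPairing.algebraMap_pairingIn]
      simp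
  have hpos : 0 < P.pairingIn ℤ i j' := by
    obtain ⟨k, hk, hk0⟩ := b.exists_mem_support_pos_pairingIn_ne_zero j'
    rw [hsum]
    refine Finset.sum_pos' (fun l hl => mul_nonneg (hf0 l) (hswap l hl)) ⟨k, hk, ?_⟩
    exact mul_pos (lt_of_le_of_ne (hf0 k) (hfull k hk).symm) (lt_of_le_of_ne (hswap k hk) hk0.symm)
  by_cases hij : i = j'
  · rw [hij]
    exact hj'T
  exfalso
  obtain ⟨l, hl⟩ := P.root_sub_root_mem_of_pairingIn_pos hpos hij
  have hht := b.height_sub hl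
  have hl0 := b.height_ne_zero l
  have h1 := hi j'
  have hlpos : b.IsPos l := by rw [b.isPos_iff]; lia
  have hiT : i ∈ T := by
    change P.root i - P.root j ∈ AddSubmonoid.closure (P.root '' (b.support : Set ι))
    have : P.root i - P.root j = P.root l + (P.root j' - P.root j) := by rw [hl]; abel
    rw [this]
    exact AddSubmonoid.add_mem _ (root_mem_closure_of_isPos hlpos) hj'T
  have := hmax i hiT
  lia

/-- The highest root `θ` is unique. -/
lemma IsHighestRoot.eq {b : P.Base} [P.IsRootSystem] {i j : ι} (hi : IsHighestRoot b i)
    (hj : IsHighestRoot b j) : i = j := by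
  classical
  have key : ∀ x ∈ AddSubmonoid.closure (P.root '' (b.support : Set ι)), ∀ k : b.support,
      0 ≤ b.toWeightBasis.coord k x := by
    intro x hx k
    induction hx using AddSubmonoid.closure_induction with
    | mem x hx =>
      obtain ⟨l, hl, rfl⟩ := hx
      have : P.root l = b.toWeightBasis ⟨l, hl⟩ := by simp
      rw [this, Module.Basis.coord_apply, Module.Basis.repr_self, Finsupp.single_apply]
      split_ifs <;> simp
    | zero => simp
    | add x y _ _ hx hy => rw [map_add]; exact add_nonneg hx hy
  apply P.root.injective
  apply b.toWeightBasis.ext_elem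
  intro k
  have h1 := key _ (hi j) k
  have h2 := key _ (hj i) k
  simp only [Module.Basis.coord_apply, map_sub] at h1 h2
  linarith

/-- The highest root `θ` of an irreducible root system with respect to the base `b`. -/
def highestRoot [Finite ι] [P.IsRootSystem] [P.IsCrystallographic] [P.IsReduced]
    [P.IsIrreducible] (b : P.Base) : M :=
  P.root (exists_isHighestRoot b).choose

end HighestRoot

section Polytope

variable {ι V N : Type*} [NormedAddCommGroup V] [InnerProductSpace ℝ V] [AddCommGroup N]
  [Module ℝ N]

/-- The root polytope: the convex hull of all roots. -/
def rootPolytope (P : RootPairing ι ℝ V N) : Set V :=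
  convexHull ℝ (Set.range P.root)

/-- A (nonempty) face of the root polytope: the whole polytope, or its intersection with a
supporting hyperplane. In `IsExposed` the polytope itself corresponds to the zero functional. -/
def IsFace (P : RootPairing ι ℝ V N) (F : Set V) : Prop :=
  F.Nonempty ∧ IsExposed ℝ (rootPolytope P) F

/-- The image `w(F)` of a set `F` of vectors under an element `w` of the Weyl group. -/
def weylImage {P : RootPairing ι ℝ V N} (w : P.weylGroup) (F : Set V) : Set V :=
  (fun x => w • x) '' F

variable {P : RootPairing ι ℝ V N} [P.IsRootSystem] [FiniteDimensional ℝ V]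

/-- The fundamental coweights: the basis of the Euclidean space dual to the basis of simple roots
with respect to the inner product. -/
def fundamentalCoweight (b : P.Base) (i : b.support) : V :=
  (InnerProductSpace.toDual ℝ V).symm
    (LinearMap.toContinuousLinearMap (b.toWeightBasis.coord i))

open scoped Classical in
lemma inner_fundamentalCoweight_root (b : P.Base) (i j : b.support) :
    ⟪fundamentalCoweight b i, P.root j⟫_ℝ = if i = j then 1 else 0 := by
  rw [fundamentalCoweight, InnerProductSpace.toDual_symm_apply, ← b.toWeightBasis_apply]
  simp [Finsupp.single_apply, eq_comm]

variable [Finite ι] [P.IsCrystallographic] [P.IsReduced] [P.IsIrreducible]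

/-- The set `F_I` of points of the root polytope at which, for every `i ∈ I`, the pairing with the
`i`-th fundamental coweight equals `m_i`, the coefficient of `α_i` in the highest root. In
particular `F_∅` is the whole polytope. -/
def standardParabolicFace (b : P.Base) (I : Set b.support) : Set V :=
  {x | x ∈ rootPolytope P ∧
    ∀ i ∈ I, ⟪fundamentalCoweight b i, x⟫_ℝ = ⟪fundamentalCoweight b i, highestRoot b⟫_ℝ}

end Polytope

end

end RootPolytope

/-!
Faces of the root polytope are the sets on which `⟪v, ·⟫` is maximal, and the Weyl group acts on
them through its action on `v`. Every vector is Weyl conjugate to a dominant one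
(`exists_smul_isDominant`). A dominant `v` is a nonnegative combination of fundamental coweights,
each of which attains its maximum over the polytope at the highest root, so the face exposed by
`v` is the standard parabolic face of the indices with nonzero coefficient
(`exposedFace_eq_standardParabolicFace`). Hence every face is conjugate to a standard parabolic one,
and every standard parabolic face is a face.

To separate the orbits, attach to `F_I` the sum of the roots it contains. This sum is dominant
(`isDominant_rootSum_standardParabolicFace`), and it moves with `F_I` under the Weyl group. Two
dominant vectors in one orbit are equal (`IsDominant.eq_of_smul_eq`, a consequence of the exchange
property `exists_shorter_word`), so conjugate faces `F_I` and `F_J` have the same number of roots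
and the same sum of roots. These two data determine the face: the inner product of the sum with a
fundamental coweight is the number of roots times the maximum of that coweight exactly when every
root of the face attains the maximum (`standardParabolicFace_subset_of_rootSum_eq`).
-/

namespace RootPolytope

/-! ### Reflections and the inner product -/

section Reflections

variable {ι V N : Type*} [NormedAddCommGroup V] [InnerProductSpace ℝ V] [AddCommGroup N]
  [Module ℝ N] {P : RootPairing ι ℝ V N}

/-- Every reflection of the root pairing `P` is an isometry. -/
def ReflectionsIsometric (P : RootPairing ι ℝ V N) : Prop :=
  ∀ (i : ι) (x y : V), ⟪P.reflection i x, P.reflection i y⟫_ℝ = ⟪x, y⟫_ℝ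

lemma ReflectionsIsometric.coroot'_mul_inner (hP : ReflectionsIsometric P) (i : ι) (x : V) :
    P.coroot' i x * ⟪P.root i, P.root i⟫_ℝ = 2 * ⟪x, P.root i⟫_ℝ := by
  have h := hP i x (P.root i)
  rw [P.reflection_apply_self, P.reflection_apply, inner_neg_right, inner_sub_left,
    real_inner_smul_left] at h
  linarith

lemma inner_root_self_pos (P : RootPairing ι ℝ V N) (i : ι) :
    0 < ⟪P.root i, P.root i⟫_ℝ :=
  real_inner_self_pos.mpr (P.ne_zero i)

lemma ReflectionsIsometric.coroot'_nonneg_iff (hP : ReflectionsIsometric P) (i : ι) (x : V) :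
    0 ≤ P.coroot' i x ↔ 0 ≤ ⟪x, P.root i⟫_ℝ := by
  have h := hP.coroot'_mul_inner i x
  have h0 := inner_root_self_pos P i
  constructor
  · intro h1
    have := mul_nonneg h1 h0.le
    linarith
  · intro h1
    exact nonneg_of_mul_nonneg_left (by linarith) h0

lemma ReflectionsIsometric.reflection_eq_self_of_inner_eq_zero (hP : ReflectionsIsometric P)
    {i : ι} {x : V} (h : ⟪x, P.root i⟫_ℝ = 0) : P.reflection i x = x := by
  have h1 := hP.coroot'_mul_inner i x
  rw [h, mul_zero, mul_eq_zero, or_iff_left (inner_root_self_pos P i).ne'] at h1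
  rw [P.reflection_apply, h1, zero_smul, sub_zero]

lemma ReflectionsIsometric.inner_smul_smul (hP : ReflectionsIsometric P) (w : P.weylGroup)
    (x y : V) : ⟪w • x, w • y⟫_ℝ = ⟪x, y⟫_ℝ := by
  revert x y
  obtain ⟨g, hg⟩ := w
  induction hg using RootPairing.weylGroup.induction with
  | mem i => exact hP i
  | one => exact fun x y => by simp
  | mul g₁ g₂ hg₁ hg₂ h₁ h₂ =>
    intro x y
    rw [← Submonoid.mk_mul_mk _ _ _ hg₁ hg₂, mul_smul, mul_smul, h₁, h₂]

end Reflections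

/-! ### The closed Weyl chamber is a fundamental domain -/

section Chamber

variable {ι V N : Type*} [NormedAddCommGroup V] [InnerProductSpace ℝ V] [AddCommGroup N]
  [Module ℝ N] {P : RootPairing ι ℝ V N}

/-- A vector in the closed Weyl chamber of the base `b`: its inner product with every simple root is
nonnegative. -/
def IsDominant (b : P.Base) (x : V) : Prop :=
  ∀ j : b.support, 0 ≤ ⟪x, P.root j⟫_ℝ

lemma IsDominant.inner_nonneg_of_isPos [Finite ι] [P.IsCrystallographic] {b : P.Base} {x : V}
    (hx : IsDominant b x) {i : ι} (hi : b.IsPos i) : 0 ≤ ⟪x, P.root i⟫_ℝ := by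
  have h := root_mem_closure_of_isPos hi
  generalize P.root i = y at h
  induction h using AddSubmonoid.closure_induction with
  | mem y hy =>
    obtain ⟨j, hj, rfl⟩ := hy
    exact hx ⟨j, hj⟩
  | zero => simp
  | add y z _ _ hy hz => rw [inner_add_right]; exact add_nonneg hy hz

lemma IsDominant.inner_nonpos_of_not_isPos [Finite ι] [P.IsCrystallographic] {b : P.Base} {x : V}
    (hx : IsDominant b x) {i : ι} (hi : ¬ b.IsPos i) : ⟪x, P.root i⟫_ℝ ≤ 0 := by
  let := P.indexNeg
  have h := hx.inner_nonneg_of_isPos ((RootPairing.Base.IsPos.or_neg b i).resolve_left hi)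
  rw [show P.root (-i) = -P.root i by simp, inner_neg_right] at h
  linarith

/-- The composite `s₁ ∘ ⋯ ∘ sₖ` of the simple reflections in a word. -/
def wordMap (b : P.Base) (L : List b.support) : V ≃ₗ[ℝ] V :=
  (L.map fun j => P.reflection j).prod

@[simp] lemma wordMap_nil (b : P.Base) : wordMap b [] = 1 := rfl

@[simp] lemma wordMap_cons (b : P.Base) (j : b.support) (L : List b.support) :
    wordMap b (j :: L) = P.reflection j * wordMap b L := by
  simp [wordMap]

@[simp] lemma wordMap_append (b : P.Base) (L L' : List b.support) :
    wordMap b (L ++ L') = wordMap b L * wordMap b L' := by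
  simp [wordMap]

lemma inner_wordMap (hP : ReflectionsIsometric P) (b : P.Base) (L : List b.support) (x y : V) :
    ⟪wordMap b L x, wordMap b L y⟫_ℝ = ⟪x, y⟫_ℝ := by
  induction L with
  | nil => simp
  | cons j L ih => rw [wordMap_cons, LinearEquiv.mul_apply, LinearEquiv.mul_apply, hP, ih]

lemma exists_wordMap_root (b : P.Base) (L : List b.support) (k : ι) :
    ∃ i, wordMap b L (P.root k) = P.root i := by
  induction L with
  | nil => exact ⟨k, by simp⟩
  | cons j L ih =>
    obtain ⟨i, hi⟩ := ih
    exact ⟨P.reflectionPerm j i, by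
      rw [wordMap_cons, LinearEquiv.mul_apply, hi, P.root_reflectionPerm]⟩

lemma wordMap_mul_reflection (hP : ReflectionsIsometric P) (b : P.Base) (L : List b.support)
    {k i : ι} (h : wordMap b L (P.root k) = P.root i) :
    wordMap b L * P.reflection k = P.reflection i * wordMap b L := by
  ext x
  have h1 : P.coroot' i (wordMap b L x) = P.coroot' k x := by
    apply mul_right_cancel₀ (inner_root_self_pos P i).ne'
    rw [hP.coroot'_mul_inner, ← h, inner_wordMap hP, inner_wordMap hP, hP.coroot'_mul_inner]
  rw [LinearEquiv.mul_apply, LinearEquiv.mul_apply, P.reflection_apply, P.reflection_apply, h1,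
    map_sub, map_smul, h]

/-- The exchange property: if a word sends the simple root `αₖ` to a negative root, then multiplying
it by `sₖ` on the right gives the same map as deleting one of its letters. -/
lemma exists_shorter_word [Finite ι] [P.IsCrystallographic] [P.IsReduced]
    (hP : ReflectionsIsometric P) (b : P.Base) (k : b.support) (L : List b.support) {i : ι}
    (h : wordMap b L (P.root k) = P.root i) (hi : ¬ b.IsPos i) :
    ∃ L', L'.length < L.length ∧ wordMap b L' = wordMap b L * P.reflection k := by
  induction L generalizing i with
  | nil =>
    have : (k : ι) = i := P.root.injective (by simpa using h)
    exact absurd (RootPairing.Base.isPos_of_mem_support k.2) (this ▸ hi)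
  | cons j L ih =>
    obtain ⟨l, hl⟩ := exists_wordMap_root b L k
    by_cases hlp : b.IsPos l
    · -- The letter `j` turns the positive root `l` into a negative one, so `l` is the simple root `j`.
      have hil : i = P.reflectionPerm j l := by
        apply P.root.injective
        rw [← h, wordMap_cons, LinearEquiv.mul_apply, hl, P.root_reflectionPerm]
      have hlj : l = j := by
        by_contra hne
        exact hi (hil ▸ hlp.reflectionPerm j.2 hne)
      refine ⟨L, by simp, ?_⟩
      rw [wordMap_cons, mul_assoc, wordMap_mul_reflection hP b L hl, hlj, ← mul_assoc]
      ext x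
      simp
    · obtain ⟨L', hlen, hL'⟩ := ih hl hlp
      exact ⟨j :: L', by simpa using hlen, by rw [wordMap_cons, wordMap_cons, hL', mul_assoc]⟩

/-- Two dominant vectors related by a product of simple reflections are equal. The last letter of a
word either sends its simple root to a negative root, and the word can be shortened, or it fixes
`x`. -/
lemma IsDominant.eq_of_wordMap_eq [Finite ι] [P.IsCrystallographic] [P.IsReduced]
    (hP : ReflectionsIsometric P) {b : P.Base} {x y : V} (hx : IsDominant b x)
    (hy : IsDominant b y) (L : List b.support) (h : wordMap b L x = y) : x = y := by
  induction hn : L.length using Nat.strong_induction_on generalizing L with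
  | _ n ih =>
    rcases List.eq_nil_or_concat' L with rfl | ⟨L₀, k, rfl⟩
    · simpa using h
    · have hmap : wordMap b (L₀ ++ [k]) = wordMap b L₀ * P.reflection k := by simp
      have hlen : L₀.length < n := by simp [← hn]
      obtain ⟨i, hi⟩ := exists_wordMap_root b L₀ k
      by_cases hip : b.IsPos i
      · have hfix : P.reflection k x = x := by
          apply hP.reflection_eq_self_of_inner_eq_zero
          refine le_antisymm ?_ (hx k)
          have h1 := hy.inner_nonneg_of_isPos hip
          rw [← h, ← hi, hmap, LinearEquiv.mul_apply, inner_wordMap hP] at h1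
          have h2 := hP k x (P.root k)
          rw [P.reflection_apply_self, inner_neg_right] at h2
          linarith
        rw [hmap, LinearEquiv.mul_apply, hfix] at h
        exact ih _ hlen L₀ h rfl
      · obtain ⟨L', hL'len, hL'⟩ := exists_shorter_word hP b k L₀ hi hip
        exact ih _ (hL'len.trans hlen) L' (by rw [hL', ← hmap, h]) rfl

/-- The Weyl group is generated by the simple reflections. -/
lemma exists_wordMap_eq_smul [Finite ι] [P.IsCrystallographic] [P.IsReduced] (b : P.Base)
    (w : P.weylGroup) : ∃ L : List b.support, ∀ x : V, w • x = wordMap b L x := by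
  obtain ⟨g, hg⟩ := w
  induction hg using RootPairing.weylGroup.induction with
  | mem i =>
    suffices ∃ L : List b.support, wordMap b L = P.reflection i by
      obtain ⟨L, hL⟩ := this
      exact ⟨L, fun x => by rw [hL]; rfl⟩
    refine b.induction_reflect i (p := fun i => ∃ L : List b.support, wordMap b L = P.reflection i)
      ?_ ?_ ?_
    · rintro i ⟨L, hL⟩
      exact ⟨L ++ L ++ L, by
        rw [P.reflection_reflectionPerm, wordMap_append, wordMap_append, hL]⟩
    · exact fun i hi => ⟨[⟨i, hi⟩], by simp⟩
    · rintro i j ⟨L, hL⟩ hj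
      exact ⟨[⟨j, hj⟩] ++ L ++ [⟨j, hj⟩], by
        rw [P.reflection_reflectionPerm, wordMap_append, wordMap_append, hL]; simp⟩
  | one => exact ⟨[], fun x => by simp⟩
  | mul g₁ g₂ hg₁ hg₂ h₁ h₂ =>
    obtain ⟨L₁, h₁⟩ := h₁
    obtain ⟨L₂, h₂⟩ := h₂
    refine ⟨L₁ ++ L₂, fun x => ?_⟩
    rw [← Submonoid.mk_mul_mk _ _ _ hg₁ hg₂, mul_smul, h₂, h₁, wordMap_append,
      LinearEquiv.mul_apply]

lemma IsDominant.eq_of_smul_eq [Finite ι] [P.IsCrystallographic] [P.IsReduced]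
    (hP : ReflectionsIsometric P) {b : P.Base} {x y : V} (hx : IsDominant b x)
    (hy : IsDominant b y) (w : P.weylGroup) (h : w • x = y) : x = y := by
  obtain ⟨L, hL⟩ := exists_wordMap_eq_smul b w
  exact hx.eq_of_wordMap_eq hP hy L (by rw [← hL, h])

lemma finite_range_weylGroup_smul [Finite ι] [P.IsRootSystem] (x : V) :
    (Set.range fun w : P.weylGroup => w • x).Finite := by
  cases nonempty_fintype ι
  have hx : x ∈ Submodule.span ℝ (Set.range P.root) := by
    rw [RootPairing.IsRootSystem.span_root_eq_top]; trivial
  obtain ⟨c, rfl⟩ := (Submodule.mem_span_range_iff_exists_fun ℝ).mp hx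
  refine (Set.finite_range fun σ : Equiv.Perm ι => ∑ i, c i • P.root (σ i)).subset ?_
  rintro _ ⟨w, rfl⟩
  refine ⟨P.weylGroupToPerm w, ?_⟩
  simp only [Finset.smul_sum]
  refine Finset.sum_congr rfl fun i _ => ?_
  rw [← P.weylGroup_apply_root]
  exact (smul_comm (w : P.Aut) (c i) (P.root i)).symm

/-- Every vector is conjugate to a dominant one: in its orbit, take the element with the largest
inner product with the sum of the fundamental coweights. -/
lemma exists_smul_isDominant [Finite ι] [P.IsRootSystem] [FiniteDimensional ℝ V]
    (hP : ReflectionsIsometric P) (b : P.Base) (x : V) :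
    ∃ w : P.weylGroup, IsDominant b (w • x) := by
  set ρ : V := ∑ i : b.support, fundamentalCoweight b i with hρ
  have hρ1 : ∀ j : b.support, ⟪ρ, P.root j⟫_ℝ = 1 := fun j => by
    classical
    simp [hρ, sum_inner, inner_fundamentalCoweight_root]
  obtain ⟨_, ⟨w, rfl⟩, hw⟩ := Set.exists_max_image _ (fun y => ⟪ρ, y⟫_ℝ)
    (finite_range_weylGroup_smul (P := P) x) ⟨_, 1, rfl⟩
  refine ⟨w, fun j => ?_⟩
  rw [← hP.coroot'_nonneg_iff]
  have h := hw _ ⟨RootPairing.weylGroup.ofIdx P j * w, rfl⟩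
  have h1 : (RootPairing.weylGroup.ofIdx P j * w) • x = P.reflection j (w • x) := by
    rw [mul_smul]; rfl
  simp only [h1, P.reflection_apply, inner_sub_right, real_inner_smul_right, hρ1] at h
  linarith

end Chamber

/-! ### Weyl group action on subsets of the root polytope -/

section WeylImage

variable {ι V N : Type*} [NormedAddCommGroup V] [InnerProductSpace ℝ V] [AddCommGroup N]
  [Module ℝ N] {P : RootPairing ι ℝ V N}

lemma root_mem_rootPolytope (P : RootPairing ι ℝ V N) (i : ι) : P.root i ∈ rootPolytope P :=
  subset_convexHull ℝ _ ⟨i, rfl⟩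

lemma smul_mem_rootPolytope (w : P.weylGroup) {x : V} (hx : x ∈ rootPolytope P) :
    w • x ∈ rootPolytope P := by
  let f : V →ₗ[ℝ] V := P.weylGroupRootRep w
  suffices rootPolytope P ⊆ f ⁻¹' rootPolytope P from this hx
  refine convexHull_min ?_ ((convex_convexHull ℝ _).linear_preimage f)
  rintro _ ⟨i, rfl⟩
  change w • P.root i ∈ rootPolytope P
  rw [P.weylGroup_apply_root]
  exact root_mem_rootPolytope P _

lemma mem_weylImage_iff {w : P.weylGroup} {F : Set V} {x : V} :
    x ∈ weylImage w F ↔ w⁻¹ • x ∈ F := by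
  constructor
  · rintro ⟨y, hy, rfl⟩
    simpa using hy
  · exact fun h => ⟨w⁻¹ • x, h, by simp⟩

lemma weylImage_mul (w₁ w₂ : P.weylGroup) (F : Set V) :
    weylImage (w₁ * w₂) F = weylImage w₁ (weylImage w₂ F) := by
  ext x
  simp only [mem_weylImage_iff, mul_inv_rev, mul_smul]

lemma weylImage_inv_weylImage (w : P.weylGroup) (F : Set V) :
    weylImage w⁻¹ (weylImage w F) = F := by
  rw [← weylImage_mul, inv_mul_cancel]
  ext x
  simp [mem_weylImage_iff]

/-- The set of points of the root polytope at which the inner product with `v` is maximal. -/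
def exposedFace (P : RootPairing ι ℝ V N) (v : V) : Set V :=
  {x | x ∈ rootPolytope P ∧ ∀ y ∈ rootPolytope P, ⟪v, y⟫_ℝ ≤ ⟪v, x⟫_ℝ}

lemma isFace_exposedFace {v : V} (h : (exposedFace P v).Nonempty) : IsFace P (exposedFace P v) :=
  ⟨h, fun _ => ⟨innerSL ℝ v, rfl⟩⟩

lemma IsFace.exists_eq_exposedFace [FiniteDimensional ℝ V] {F : Set V} (hF : IsFace P F) :
    ∃ v, F = exposedFace P v := by
  obtain ⟨l, hl⟩ := hF.2 hF.1
  refine ⟨(InnerProductSpace.toDual ℝ V).symm l, ?_⟩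
  simpa [exposedFace, InnerProductSpace.toDual_symm_apply] using hl

lemma weylImage_exposedFace (hP : ReflectionsIsometric P) (w : P.weylGroup) (v : V) :
    weylImage w (exposedFace P v) = exposedFace P (w • v) := by
  ext x
  rw [mem_weylImage_iff]
  have hinner : ∀ y : V, ⟪v, w⁻¹ • y⟫_ℝ = ⟪w • v, y⟫_ℝ := fun y => by
    rw [← hP.inner_smul_smul w, smul_inv_smul]
  constructor
  · rintro ⟨h1, h2⟩
    refine ⟨by simpa using smul_mem_rootPolytope w h1, fun y hy => ?_⟩
    rw [← hinner, ← hinner]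
    exact h2 _ (smul_mem_rootPolytope w⁻¹ hy)
  · rintro ⟨h1, h2⟩
    refine ⟨smul_mem_rootPolytope w⁻¹ h1, fun y hy => ?_⟩
    rw [hinner, ← inv_smul_smul w y, hinner]
    exact h2 _ (smul_mem_rootPolytope w hy)

lemma IsFace.weylImage [FiniteDimensional ℝ V] (hP : ReflectionsIsometric P)
    (w : P.weylGroup) {F : Set V} (hF : IsFace P F) : IsFace P (weylImage w F) := by
  obtain ⟨v, rfl⟩ := hF.exists_eq_exposedFace
  have hne : (RootPolytope.weylImage w (exposedFace P v)).Nonempty := hF.1.image _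
  rw [weylImage_exposedFace hP] at hne ⊢
  exact isFace_exposedFace hne

variable [Finite ι]

/-- The indices of the roots lying in `F`. -/
noncomputable def rootsIn (P : RootPairing ι ℝ V N) (F : Set V) : Finset ι :=
  (Set.toFinite {i | P.root i ∈ F}).toFinset

@[simp] lemma mem_rootsIn {F : Set V} {i : ι} : i ∈ rootsIn P F ↔ P.root i ∈ F := by
  simp [rootsIn]

/-- The sum of the roots lying in `F`. -/
noncomputable def rootSum (P : RootPairing ι ℝ V N) (F : Set V) : V :=
  ∑ i ∈ rootsIn P F, P.root i

lemma rootsIn_weylImage (w : P.weylGroup) (F : Set V) :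
    rootsIn P (weylImage w F) = (rootsIn P F).map (P.weylGroupToPerm w).toEmbedding := by
  ext i
  rw [mem_rootsIn, mem_weylImage_iff, Finset.mem_map_equiv, mem_rootsIn, P.weylGroup_apply_root,
    map_inv]
  rfl

lemma card_rootsIn_weylImage (w : P.weylGroup) (F : Set V) :
    (rootsIn P (weylImage w F)).card = (rootsIn P F).card := by
  rw [rootsIn_weylImage, Finset.card_map]

lemma rootSum_weylImage (w : P.weylGroup) (F : Set V) :
    rootSum P (weylImage w F) = w • rootSum P F := by
  rw [rootSum, rootsIn_weylImage, Finset.sum_map, rootSum, Finset.smul_sum]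
  exact Finset.sum_congr rfl fun i _ => (P.weylGroup_apply_root w i).symm

end WeylImage

/-! ### Standard parabolic faces -/

section StandardParabolicFace

variable {ι V N : Type*} [NormedAddCommGroup V] [InnerProductSpace ℝ V]
  [FiniteDimensional ℝ V] [AddCommGroup N] [Module ℝ N]
  {P : RootPairing ι ℝ V N} [P.IsRootSystem]

/-- A vector is the combination of the fundamental coweights with coefficients its inner products
with the simple roots. -/
lemma sum_inner_smul_fundamentalCoweight (b : P.Base) (v : V) :
    ∑ i : b.support, ⟪v, P.root i⟫_ℝ • fundamentalCoweight b i = v := by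
  classical
  refine InnerProductSpace.ext_inner_right_basis b.toWeightBasis fun j => ?_
  simp [sum_inner, real_inner_smul_left, inner_fundamentalCoweight_root]

variable [Finite ι] [P.IsCrystallographic] [P.IsReduced] [P.IsIrreducible]

lemma inner_fundamentalCoweight_root_le (b : P.Base) (i : b.support) (j : ι) :
    ⟪fundamentalCoweight b i, P.root j⟫_ℝ ≤ ⟪fundamentalCoweight b i, highestRoot b⟫_ℝ := by
  classical
  have h : highestRoot b - P.root j ∈ AddSubmonoid.closure (P.root '' (b.support : Set ι)) :=
    (exists_isHighestRoot b).choose_spec j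
  rw [← sub_nonneg, ← inner_sub_right]
  generalize highestRoot b - P.root j = x at h
  induction h using AddSubmonoid.closure_induction with
  | mem x hx =>
    obtain ⟨k, hk, rfl⟩ := hx
    rw [inner_fundamentalCoweight_root b i ⟨k, hk⟩]
    split_ifs <;> simp
  | zero => simp
  | add x y _ _ hx hy => rw [inner_add_right]; exact add_nonneg hx hy

lemma inner_fundamentalCoweight_le (b : P.Base) (i : b.support) {x : V}
    (hx : x ∈ rootPolytope P) :
    ⟪fundamentalCoweight b i, x⟫_ℝ ≤ ⟪fundamentalCoweight b i, highestRoot b⟫_ℝ := by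
  suffices rootPolytope P ⊆ {y | innerₛₗ ℝ (fundamentalCoweight b i) y ≤
      ⟪fundamentalCoweight b i, highestRoot b⟫_ℝ} from this hx
  refine convexHull_min ?_ (convex_halfSpace_le (LinearMap.isLinear _) _)
  rintro _ ⟨j, rfl⟩
  exact inner_fundamentalCoweight_root_le b i j

lemma highestRoot_mem_standardParabolicFace (b : P.Base) (I : Set b.support) :
    highestRoot b ∈ standardParabolicFace b I :=
  ⟨root_mem_rootPolytope P _, fun _ _ => rfl⟩

/-- The face of the root polytope exposed by a dominant vector is the standard parabolic face of
the simple roots not orthogonal to that vector: all the inner products with the fundamental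
coweights are maximal at the highest root. -/
lemma exposedFace_eq_standardParabolicFace (b : P.Base) {v : V} (hv : IsDominant b v) :
    exposedFace P v = standardParabolicFace b {i | ⟪v, P.root i⟫_ℝ ≠ 0} := by
  have hsum : ∀ x, ⟪v, x⟫_ℝ =
      ∑ i : b.support, ⟪v, P.root i⟫_ℝ * ⟪fundamentalCoweight b i, x⟫_ℝ := fun x => by
    conv_lhs => rw [← sum_inner_smul_fundamentalCoweight b v]
    simp [sum_inner, real_inner_smul_left]
  have hle : ∀ y ∈ rootPolytope P, ∀ i : b.support,
      ⟪v, P.root i⟫_ℝ * ⟪fundamentalCoweight b i, y⟫_ℝ ≤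
        ⟪v, P.root i⟫_ℝ * ⟪fundamentalCoweight b i, highestRoot b⟫_ℝ := fun y hy i =>
    mul_le_mul_of_nonneg_left (inner_fundamentalCoweight_le b i hy) (hv i)
  have hθ : ∀ y ∈ rootPolytope P, ⟪v, y⟫_ℝ ≤ ⟪v, highestRoot b⟫_ℝ := fun y hy => by
    rw [hsum, hsum]
    exact Finset.sum_le_sum fun i _ => hle y hy i
  ext x
  refine and_congr_right fun hx => ?_
  have h1 : (∀ y ∈ rootPolytope P, ⟪v, y⟫_ℝ ≤ ⟪v, x⟫_ℝ) ↔ ⟪v, x⟫_ℝ = ⟪v, highestRoot b⟫_ℝ :=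
    ⟨fun h => le_antisymm (hθ x hx) (h _ (root_mem_rootPolytope P _)),
      fun h y hy => h ▸ hθ y hy⟩
  rw [h1, hsum, hsum, Finset.sum_eq_sum_iff_of_le fun i _ => hle x hx i]
  refine ⟨fun h i hi => mul_left_cancel₀ hi (h i (Finset.mem_univ i)), fun h i _ => ?_⟩
  by_cases hi : ⟪v, P.root i⟫_ℝ = 0
  · simp [hi]
  · rw [h i hi]

lemma isFace_standardParabolicFace (b : P.Base) (I : Set b.support) :
    IsFace P (standardParabolicFace b I) := by
  classical
  set v : V := ∑ i : b.support with i ∈ I, fundamentalCoweight b i with hv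
  have hv1 : ∀ j : b.support, ⟪v, P.root j⟫_ℝ = if j ∈ I then 1 else 0 := fun j => by
    simp [hv, sum_inner, inner_fundamentalCoweight_root]
  have hdom : IsDominant b v := fun j => by rw [hv1]; split_ifs <;> simp
  have h := exposedFace_eq_standardParabolicFace b hdom
  have hI : {i : b.support | ⟪v, P.root i⟫_ℝ ≠ 0} = I := by ext i; simp [hv1]
  rw [hI] at h
  rw [← h]
  exact isFace_exposedFace (h ▸ ⟨_, highestRoot_mem_standardParabolicFace b I⟩)

/-- For `i ∈ I`, a root of `F_I` cannot be raised by `αᵢ`, so its inner product with `αᵢ` is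
nonnegative. -/
lemma inner_root_nonneg_of_mem_standardParabolicFace (hP : ReflectionsIsometric P) (b : P.Base)
    {I : Set b.support} {i : b.support} (hi : i ∈ I) {j : ι}
    (hj : P.root j ∈ standardParabolicFace b I) : 0 ≤ ⟪P.root j, P.root i⟫_ℝ := by
  classical
  have hmax := hj.2 i hi
  have hii : ⟪fundamentalCoweight b i, P.root i⟫_ℝ = 1 := by
    rw [inner_fundamentalCoweight_root, if_pos rfl]
  rw [← hP.coroot'_nonneg_iff, P.root_coroot'_eq_pairing]
  by_contra! hneg
  have hne : P.root j ≠ -P.root i := fun h => by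
    have h1 := inner_fundamentalCoweight_root_le b i i
    rw [← hmax, h, inner_neg_right, hii] at h1
    linarith
  have hneg' : P.pairingIn ℤ j i < 0 := by
    rw [← P.algebraMap_pairingIn ℤ] at hneg
    simpa using hneg
  obtain ⟨l, hl⟩ := P.root_add_root_mem_of_pairingIn_neg hneg' hne
  have h1 := inner_fundamentalCoweight_root_le b i l
  rw [hl, inner_add_right, hii, hmax] at h1
  linarith

lemma weylImage_ofIdx_standardParabolicFace (b : P.Base) {I : Set b.support} {i : b.support}
    (hi : i ∉ I) :
    weylImage (RootPairing.weylGroup.ofIdx P i) (standardParabolicFace b I) =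
      standardParabolicFace b I := by
  classical
  have hsub : ∀ x ∈ standardParabolicFace b I,
      P.reflection i x ∈ standardParabolicFace b I := fun x hx => by
    refine ⟨smul_mem_rootPolytope (RootPairing.weylGroup.ofIdx P i) hx.1, fun j hj => ?_⟩
    have hne : j ≠ i := fun h => hi (h ▸ hj)
    rw [P.reflection_apply, inner_sub_right, real_inner_smul_right,
      inner_fundamentalCoweight_root, if_neg hne, mul_zero, sub_zero, hx.2 j hj]
  apply Set.Subset.antisymm
  · rintro _ ⟨x, hx, rfl⟩
    exact hsub x hx
  · exact fun x hx => ⟨P.reflection i x, hsub x hx, P.reflection_same i x⟩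

/-- The sum of the roots in `F_I` is dominant: it is orthogonal to the simple roots outside `I`,
whose reflections preserve `F_I`, and each summand has nonnegative inner product with the simple
roots in `I`. -/
lemma isDominant_rootSum_standardParabolicFace (hP : ReflectionsIsometric P) (b : P.Base)
    (I : Set b.support) : IsDominant b (rootSum P (standardParabolicFace b I)) := by
  intro i
  by_cases hi : i ∈ I
  · rw [rootSum, sum_inner]
    exact Finset.sum_nonneg fun j hj =>
      inner_root_nonneg_of_mem_standardParabolicFace hP b hi (mem_rootsIn.mp hj)
  · have h := rootSum_weylImage (RootPairing.weylGroup.ofIdx P i) (standardParabolicFace b I)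
    rw [weylImage_ofIdx_standardParabolicFace b hi] at h
    have h1 := hP i (rootSum P (standardParabolicFace b I)) (P.root i)
    rw [P.reflection_apply_self, inner_neg_right] at h1
    change _ = P.reflection i _ at h
    rw [← h] at h1
    linarith

/-- A point of `F_J` is a convex combination of the roots in `F_J`, so `F_J ⊆ F_I` can be tested on
roots. -/
lemma standardParabolicFace_subset_of_rootsIn_subset (b : P.Base) {I J : Set b.support}
    (h : rootsIn P (standardParabolicFace b J) ⊆ rootsIn P (standardParabolicFace b I)) :
    standardParabolicFace b J ⊆ standardParabolicFace b I := by
  cases nonempty_fintype ι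
  rintro x ⟨hxP, hxJ⟩
  refine ⟨hxP, fun i hi => ?_⟩
  obtain ⟨c, hc0, hc1, rfl⟩ : ∃ c : ι → ℝ, (∀ k, 0 ≤ c k) ∧ ∑ k, c k = 1 ∧
      ∑ k, c k • P.root k = x := by
    have hx : x ∈ convexHull ℝ (Finset.univ.map P.root : Set V) := by
      simpa [rootPolytope] using hxP
    obtain ⟨c, hc0, hc1, hcx⟩ := Finset.mem_convexHull'.mp hx
    rw [Finset.sum_map] at hc1 hcx
    exact ⟨fun k => c (P.root k), fun k => hc0 _ (by simp), hc1, hcx⟩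
  have hle : ∀ (j : b.support) (k : ι), c k * ⟪fundamentalCoweight b j, P.root k⟫_ℝ ≤
      c k * ⟪fundamentalCoweight b j, highestRoot b⟫_ℝ := fun j k =>
    mul_le_mul_of_nonneg_left (inner_fundamentalCoweight_root_le b j k) (hc0 k)
  have hiff : ∀ j : b.support, ⟪fundamentalCoweight b j, ∑ k, c k • P.root k⟫_ℝ =
      ⟪fundamentalCoweight b j, highestRoot b⟫_ℝ ↔
      ∀ k, c k * ⟪fundamentalCoweight b j, P.root k⟫_ℝ =
        c k * ⟪fundamentalCoweight b j, highestRoot b⟫_ℝ := fun j => by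
    have h1 : ⟪fundamentalCoweight b j, highestRoot b⟫_ℝ =
        ∑ k, c k * ⟪fundamentalCoweight b j, highestRoot b⟫_ℝ := by
      rw [← Finset.sum_mul, hc1, one_mul]
    rw [inner_sum]
    simp only [real_inner_smul_right]
    conv_lhs => rw [h1]
    simpa using Finset.sum_eq_sum_iff_of_le fun k (_ : k ∈ Finset.univ) => hle j k
  refine (hiff i).mpr fun k => ?_
  by_cases hk : c k = 0
  · simp [hk]
  · have hkJ : k ∈ rootsIn P (standardParabolicFace b J) := mem_rootsIn.mpr
      ⟨root_mem_rootPolytope P k, fun j hj => mul_left_cancel₀ hk ((hiff j).mp (hxJ j hj) k)⟩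
    rw [(mem_rootsIn.mp (h hkJ)).2 i hi]

/-- If `F_I` and `F_J` contain equally many roots and these have the same sum, then `F_J ⊆ F_I`: the
inner product of the sum with `ω̆ᵢ`, `i ∈ I`, has the largest value that this number of roots
allows. -/
lemma standardParabolicFace_subset_of_rootSum_eq (b : P.Base) {I J : Set b.support}
    (hcard : (rootsIn P (standardParabolicFace b I)).card =
      (rootsIn P (standardParabolicFace b J)).card)
    (hsum : rootSum P (standardParabolicFace b I) = rootSum P (standardParabolicFace b J)) :
    standardParabolicFace b J ⊆ standardParabolicFace b I := by
  refine standardParabolicFace_subset_of_rootsIn_subset b fun k hk => ?_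
  rw [mem_rootsIn]
  refine ⟨root_mem_rootPolytope P k, fun i hi => ?_⟩
  have hJ : ∑ k ∈ rootsIn P (standardParabolicFace b J), ⟪fundamentalCoweight b i, P.root k⟫_ℝ =
      ∑ k ∈ rootsIn P (standardParabolicFace b J),
        ⟪fundamentalCoweight b i, highestRoot b⟫_ℝ := by
    rw [← inner_sum]
    change ⟪_, rootSum P (standardParabolicFace b J)⟫_ℝ = _
    rw [← hsum, rootSum, inner_sum, Finset.sum_congr rfl fun k hk => (mem_rootsIn.mp hk).2 i hi,
      Finset.sum_const, Finset.sum_const, hcard]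
  exact (Finset.sum_eq_sum_iff_of_le fun k _ =>
    inner_fundamentalCoweight_root_le b i k).mp hJ k hk

theorem standardParabolicFace_eq_of_weylImage_eq (hP : ReflectionsIsometric P) (b : P.Base)
    {I J : Set b.support} (w : P.weylGroup)
    (h : weylImage w (standardParabolicFace b I) = standardParabolicFace b J) :
    standardParabolicFace b I = standardParabolicFace b J := by
  have hcard : (rootsIn P (standardParabolicFace b I)).card =
      (rootsIn P (standardParabolicFace b J)).card := by
    rw [← h, card_rootsIn_weylImage]
  have hsum : rootSum P (standardParabolicFace b I) = rootSum P (standardParabolicFace b J) :=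
    (isDominant_rootSum_standardParabolicFace hP b I).eq_of_smul_eq hP
      (isDominant_rootSum_standardParabolicFace hP b J) w (by rw [← h, rootSum_weylImage])
  exact (standardParabolicFace_subset_of_rootSum_eq b hcard.symm hsum.symm).antisymm
    (standardParabolicFace_subset_of_rootSum_eq b hcard hsum)

theorem IsFace.exists_weylImage_eq (hP : ReflectionsIsometric P) (b : P.Base) {F : Set V}
    (hF : IsFace P F) :
    ∃ (w : P.weylGroup) (I : Set b.support),
      RootPolytope.weylImage w F = standardParabolicFace b I := by
  obtain ⟨v, rfl⟩ := hF.exists_eq_exposedFace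
  obtain ⟨w, hw⟩ := exists_smul_isDominant hP b v
  exact ⟨w, _, (weylImage_exposedFace hP w v).trans (exposedFace_eq_standardParabolicFace b hw)⟩

end StandardParabolicFace

end RootPolytope

theorem proposition5p1 {ι V N : Type*} [Finite ι]
    [NormedAddCommGroup V] [InnerProductSpace ℝ V] [FiniteDimensional ℝ V]
    [AddCommGroup N] [Module ℝ N]
    (P : RootPairing ι ℝ V N) [P.IsRootSystem] [P.IsCrystallographic] [P.IsReduced]
    [P.IsIrreducible]
    (hP : ∀ (i : ι) (x y : V), ⟪P.reflection i x, P.reflection i y⟫_ℝ = ⟪x, y⟫_ℝ)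
    (b : P.Base) :
    -- distinct standard parabolic faces are not conjugate under the Weyl group
    (∀ I J : Set b.support,
      RootPolytope.standardParabolicFace b I ≠ RootPolytope.standardParabolicFace b J →
      ¬ ∃ w : P.weylGroup,
        RootPolytope.weylImage w (RootPolytope.standardParabolicFace b I) =
          RootPolytope.standardParabolicFace b J) ∧
    -- the Weyl group permutes the faces, and the standard parabolic faces form a complete
    -- set of representatives of its orbits
    (∀ (w : P.weylGroup) (F : Set V), RootPolytope.IsFace P F →
      RootPolytope.IsFace P (RootPolytope.weylImage w F)) ∧
    (∀ I : Set b.support, RootPolytope.IsFace P (RootPolytope.standardParabolicFace b I)) ∧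
    (∀ F : Set V, RootPolytope.IsFace P F →
      ∃! G : Set V, (∃ I : Set b.support, G = RootPolytope.standardParabolicFace b I) ∧
        ∃ w : P.weylGroup, RootPolytope.weylImage w F = G) := by
  have hP' : RootPolytope.ReflectionsIsometric P := hP
  refine ⟨fun I J hne ⟨w, hw⟩ =>
      hne (RootPolytope.standardParabolicFace_eq_of_weylImage_eq hP' b w hw),
    fun w F hF => hF.weylImage hP' w, RootPolytope.isFace_standardParabolicFace b,
    fun F hF => ?_⟩
  obtain ⟨w, I, hwI⟩ := hF.exists_weylImage_eq hP' b
  refine ⟨_, ⟨⟨I, rfl⟩, w, hwI⟩, ?_⟩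
  rintro _ ⟨⟨J, rfl⟩, w', hw'⟩
  refine RootPolytope.standardParabolicFace_eq_of_weylImage_eq hP' b (w * w'⁻¹) ?_
  rw [← hw', RootPolytope.weylImage_mul, RootPolytope.weylImage_inv_weylImage, hwI]
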